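/- Let $n\ge 0$ and let $S_n$ be the symmetric group on $\{1,\dots,n\}$ with simple transpositions $s_i=(i\ i{+}1)$, $1\le i\le n-1$; products are compositions of maps, $(xs)(j)=x(s(j))$. Let $\ell$ be the length with respect to the $s_i$ and let $<$ be the (strict) Bruhat order. The (right) weak Bruhat order $\le_{w}$ is the reflexive and transitive closure of the relations $u\le_w us$ for $s$ simple with $\ell(u)<\ell(us)$. Let $w\mapsto (P(w),Q(w))$ be the Robinson–Schensted correspondence (row insertion of the word $w(1),w(2),\dots,w(n)$), and for a partition $\lambda$ of $n$ let $J_\lambda\subseteq S_n$ be the set of all $w$ such that $P(w)$ and $Q(w)$ have shape $\lambda$ (these sets are the two-sided cells of $S_n$). For partitions of $n$ (with parts in weakly decreasing order), the dominance order is: $\mu\le\lambda$ iff $\sum_{i=1}^k\mu_i\le\sum_{i=1}^k\lambda_i$ for all $k\ge1$. The dominance order on partitions of $n$ is generated by the weak Bruhat order under the Robinson–Schensted correspondence. That is: 1. For all partitions $\lambda,\mu$ of $n$, one has $\mu\le\lambda$ in the dominance order if and only if there is a chain $\mu=\mu^{(0)},\mu^{(1)},\dots,\mu^{(r)}=\lambda$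 ($r\ge0$) of partitions of $n$ such that for each $1\le j\le r$ there are $x\in J_{\mu^{(j-1)}}$ and $y\in J_{\mu^{(j)}}$ with $y\le_w x$. 2. Whenever $\lambda>\mu$ in the dominance order, there are $x\in J_\mu$, a simple transposition $s$ and a partition $\nu$ of $n$ with $xs<x$, $xs\in J_\nu$ and $\lambda\ge\nu>\mu$. -/

import Mathlib

namespace DominanceWeakOrder

/-! ### The symmetric group: length, Bruhat order, weak order -/

/-- The simple transpositions `s_i = (i i+1)` of the symmetric group on `n` letters. -/
def IsSimple {n : ℕ} (s : Equiv.Perm (Fin n)) : Prop :=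
  ∃ i j : Fin n, (i : ℕ) + 1 = (j : ℕ) ∧ s = Equiv.swap i j

/-- The Coxeter length: the least number of simple transpositions whose product is `w`. -/
noncomputable def length {n : ℕ} (w : Equiv.Perm (Fin n)) : ℕ :=
  sInf {k : ℕ | ∃ l : List (Equiv.Perm (Fin n)), (∀ s ∈ l, IsSimple s) ∧ l.prod = w ∧ l.length = k}

/-- The strict Bruhat order: generated by `u < u * t` for `t` a reflection (that is, a
transposition) with `length u < length (u * t)`. -/
def BruhatLT {n : ℕ} : Equiv.Perm (Fin n) → Equiv.Perm (Fin n) → Prop :=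
  Relation.TransGen fun u v => ∃ t : Equiv.Perm (Fin n), t.IsSwap ∧ v = u * t ∧ length u < length v

/-- The (right) weak Bruhat order: generated by `u ≤ u * s` for `s` a simple transposition with
`length u < length (u * s)`. -/
def WeakLE {n : ℕ} : Equiv.Perm (Fin n) → Equiv.Perm (Fin n) → Prop :=
  Relation.ReflTransGen fun u v =>
    ∃ s : Equiv.Perm (Fin n), IsSimple s ∧ v = u * s ∧ length u < length v

/-! ### The Robinson–Schensted correspondence -/

/-- A filling of a diagram by natural numbers, given as the list of its rows, from the top. -/
abbrev Tableau : Type := List (List ℕ)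

/-- The list of the row lengths of a tableau. -/
def Tableau.shape (T : Tableau) : List ℕ := T.map List.length

/-- Row insertion of `a` into a row: `a` replaces the leftmost entry larger than `a`, which is
bumped out and returned; if there is none, `a` is appended at the end. -/
def rowInsert (a : ℕ) : List ℕ → List ℕ × Option ℕ
  | [] => ([a], none)
  | b :: r => if a < b then (a :: r, some b) else (b :: (rowInsert a r).1, (rowInsert a r).2)

/-- Row bumping: insert `a` into the first row, insert the bumped entry into the second row, and
so on. Returns the new tableau and the index (from `0`) of the row that became longer. -/
def insert (a : ℕ) : Tableau → Tableau × ℕ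
  | [] => ([[a]], 0)
  | r :: T =>
    match rowInsert a r with
    | (r', none) => (r' :: T, 0)
    | (r', some b) => (r' :: (insert b T).1, (insert b T).2 + 1)

/-- Add a box with entry `k` at the end of the row with index `i` (a new last row if there is no
such row). -/
def addBox (k : ℕ) : Tableau → ℕ → Tableau
  | [], _ => [[k]]
  | r :: T, 0 => (r ++ [k]) :: T
  | r :: T, i + 1 => r :: addBox k T i

/-- One step of the algorithm: insert the value `a` into the first tableau, and record the new box
by the label `k` in the second. -/
def rsStep (PQ : Tableau × Tableau) (a k : ℕ) : Tableau × Tableau :=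
  ((insert a PQ.1).1, addBox k PQ.2 (insert a PQ.1).2)

/-- The Robinson–Schensted correspondence `w ↦ (P(w), Q(w))`: insert `w(1), …, w(n)` in turn.
The letters `1, …, n` are the elements `0, …, n - 1` of `Fin n`, shifted by one. -/
def robinsonSchensted {n : ℕ} (w : Equiv.Perm (Fin n)) : Tableau × Tableau :=
  (List.finRange n).foldl (fun PQ i => rsStep PQ ((w i : ℕ) + 1) ((i : ℕ) + 1)) ([], [])

/-- The insertion tableau `P(w)`. -/
def P {n : ℕ} (w : Equiv.Perm (Fin n)) : Tableau := (robinsonSchensted w).1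

/-- The recording tableau `Q(w)`. -/
def Q {n : ℕ} (w : Equiv.Perm (Fin n)) : Tableau := (robinsonSchensted w).2

theorem rowInsert_none {a : ℕ} : ∀ {r r' : List ℕ}, rowInsert a r = (r', none) →
    r'.length = r.length + 1
  | [], r', h => by simp [rowInsert] at h; simp [← h]
  | b :: r, r', h => by
    rw [rowInsert] at h
    split_ifs at h with hab
    · simp at h
    · have h1 : r' = b :: (rowInsert a r).1 := by simpa using (congrArg Prod.fst h).symm
      have h2 : (rowInsert a r).2 = none := by simpa using congrArg Prod.snd h
      have := rowInsert_none (a := a) (r := r) (show rowInsert a r = (_, _) from Prod.ext rfl h2)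
      simp [h1, this]

theorem rowInsert_some {a b : ℕ} : ∀ {r r' : List ℕ}, rowInsert a r = (r', some b) →
    r'.length = r.length
  | [], r', h => by simp [rowInsert] at h
  | c :: r, r', h => by
    rw [rowInsert] at h
    split_ifs at h with hab
    · have h1 : r' = a :: r := by simpa using (congrArg Prod.fst h).symm
      simp [h1]
    · have h1 : r' = c :: (rowInsert a r).1 := by simpa using (congrArg Prod.fst h).symm
      have h2 : (rowInsert a r).2 = some b := by simpa using congrArg Prod.snd h
      have := rowInsert_some (a := a) (r := r) (show rowInsert a r = (_, _) from Prod.ext rfl h2)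
      simp [h1, this]

theorem shape_insert (k : ℕ) : ∀ (a : ℕ) (T U : Tableau), T.shape = U.shape →
    (insert a T).1.shape = (addBox k U (insert a T).2).shape
  | a, [], [], _ => by simp [insert, addBox, Tableau.shape]
  | a, [], u :: U, h => by simp [Tableau.shape] at h
  | a, r :: T, [], h => by simp [Tableau.shape] at h
  | a, r :: T, u :: U, h => by
    simp only [Tableau.shape, List.map_cons, List.cons.injEq] at h
    rw [insert]
    split
    · next r' hr =>
      simp [addBox, Tableau.shape, rowInsert_none hr, h.1, h.2]
    · next r' b hr =>
      have ih := shape_insert k b T U h.2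
      simp only [Tableau.shape] at ih
      simp [addBox, Tableau.shape, rowInsert_some hr, h.1, ih]

/-- The two tableaux of a permutation have the same shape. -/
theorem shape_P_eq_shape_Q {n : ℕ} (w : Equiv.Perm (Fin n)) : (P w).shape = (Q w).shape := by
  have key : ∀ (l : List (Fin n)) (PQ : Tableau × Tableau), PQ.1.shape = PQ.2.shape →
      (l.foldl (fun PQ i => rsStep PQ ((w i : ℕ) + 1) ((i : ℕ) + 1)) PQ).1.shape =
        (l.foldl (fun PQ i => rsStep PQ ((w i : ℕ) + 1) ((i : ℕ) + 1)) PQ).2.shape := by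
    intro l
    induction l with
    | nil => intro PQ h; exact h
    | cons i l ih => intro PQ h; exact ih _ (shape_insert _ _ _ _ h)
  exact key _ _ rfl

/-! ### Partitions -/

/-- The parts of a partition in weakly decreasing order. -/
def sortedParts {n : ℕ} (lam : n.Partition) : List ℕ := lam.parts.sort (· ≥ ·)

/-- The dominance order `lam ≤ mu`: for every `k`, the sum of the `k` largest parts of `lam` is
at most that of `mu`. -/
def DomLE {n : ℕ} (lam mu : n.Partition) : Prop :=
  ∀ k : ℕ, ((sortedParts lam).take k).sum ≤ ((sortedParts mu).take k).sum

/-- The strict dominance order. -/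
def DomLT {n : ℕ} (lam mu : n.Partition) : Prop := DomLE lam mu ∧ lam ≠ mu

/-- The set `J lam` of all permutations whose tableaux under the Robinson–Schensted correspondence
have shape `lam`. -/
def J {n : ℕ} (lam : n.Partition) : Set (Equiv.Perm (Fin n)) :=
  {w | (Q w).shape = sortedParts lam}

end DominanceWeakOrder

namespace DominanceWeakOrder

/-! ### Length and inversions -/

/-! Everything rests on Greene's theorem (`coveredBy_iff`): the first `k` rows of the insertion
tableau contain as many boxes as `k` disjoint increasing subwords can cover letters. It holds
because Knuth moves preserve these maxima, a word is Knuth equivalent to the reading word of its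
tableau, and for reading words the maxima can be computed by hand.

Going down in the weak order undoes inversions of adjacent letters, so every family of increasing
subwords survives and the shape can only rise in dominance (`domLE_of_weakLE`). This gives one half
of the first claim.

Conversely, let `mu < lam`. Some box of `mu` can be moved from a row `j` up to a row `i` so that the
result `nu` is still below `lam` (`exists_rows`). This move is realized by a single descent
(`exists_word_move`). Concatenating words whose letters lie in successive intervals adds row
lengths, so it suffices to treat two columns, of heights `i` and `j + 1`. They come from `i`
increasing pairs followed by a decreasing run; exchanging the first two letters of the run creates
one more pair, and the heights become `i + 1` and `j`. The rest of `mu` is supplied by an unrelated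
word. This proves the second claim, and iterating it gives the chain, since there are finitely many
partitions. -/

theorem exists_shorter_prod {n : ℕ} {a b : Fin n} (hab : a < b) :
    ∀ l : List (Equiv.Perm (Fin n)), (∀ s ∈ l, IsSimple s) → l.prod b < l.prod a →
      ∃ l' : List (Equiv.Perm (Fin n)), (∀ s ∈ l', IsSimple s) ∧
        l'.prod = l.prod * Equiv.swap a b ∧ l'.length < l.length
  | [], _, h => absurd h (by simpa using hab.le)
  | s :: l, hl, h => by
    by_cases hlt : l.prod b < l.prod a
    · obtain ⟨l', h1, h2, h3⟩ := exists_shorter_prod hab l (fun t ht => hl t (by simp [ht])) hlt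
      refine ⟨s :: l', ?_, by simp [h2, mul_assoc], by simpa using h3⟩
      simpa using ⟨hl s (by simp), h1⟩
    -- Exchange argument: `s` inverts two values that `l.prod` leaves in order, so `s` is the
    -- transposition of these two values. Multiplying by `swap a b` on the right then amounts to
    -- deleting `s`.
    · have hne : l.prod a ≠ l.prod b := fun e => hab.ne (l.prod.injective e)
      obtain ⟨i, j, hij, hs⟩ := hl s (by simp)
      rw [List.prod_cons, Equiv.Perm.mul_apply, Equiv.Perm.mul_apply] at h
      have key : s = Equiv.swap (l.prod a) (l.prod b) := by
        generalize l.prod a = p at *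
        generalize l.prod b = q at *
        subst hs
        rw [Equiv.swap_apply_def, Equiv.swap_apply_def] at h
        have : p = i ∧ q = j := by
          simp only [Fin.ext_iff, Fin.lt_def] at *
          split_ifs at h <;> omega
        rw [this.1, this.2]
      refine ⟨l, fun t ht => hl t (by simp [ht]), ?_, by simp⟩
      rw [List.prod_cons, mul_assoc, Equiv.mul_swap_eq_swap_mul, ← key, ← mul_assoc]
      rw [key, Equiv.swap_mul_self, one_mul]

theorem exists_simple_prod {n : ℕ} (w : Equiv.Perm (Fin n)) :
    ∃ l : List (Equiv.Perm (Fin n)), (∀ s ∈ l, IsSimple s) ∧ l.prod = w := by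
  cases n with
  | zero => exact ⟨[], by simp, Subsingleton.elim _ _⟩
  | succ n =>
    have hw : w ∈ Submonoid.closure
        (Set.range fun i : Fin n => Equiv.swap i.castSucc i.succ) := by
      rw [Equiv.Perm.mclosure_swap_castSucc_succ]; trivial
    obtain ⟨l, hl, hp⟩ := Submonoid.exists_list_of_mem_closure hw
    refine ⟨l, fun s hs => ?_, hp⟩
    obtain ⟨i, rfl⟩ := hl s hs
    exact ⟨i.castSucc, i.succ, by simp, rfl⟩

/-- Removing an inversion by a transposition decreases the length. -/
theorem length_mul_swap_lt {n : ℕ} {a b : Fin n} (hab : a < b) {w : Equiv.Perm (Fin n)}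
    (h : w b < w a) : length (w * Equiv.swap a b) < length w := by
  have hne : {k : ℕ | ∃ l : List (Equiv.Perm (Fin n)),
      (∀ s ∈ l, IsSimple s) ∧ l.prod = w ∧ l.length = k}.Nonempty := by
    obtain ⟨l, h1, h2⟩ := exists_simple_prod w
    exact ⟨_, l, h1, h2, rfl⟩
  obtain ⟨l, h1, rfl, h3⟩ := Nat.sInf_mem hne
  obtain ⟨l', h1', h2', h3'⟩ := exists_shorter_prod hab l h1 h
  have : length (l.prod * Equiv.swap a b) ≤ l'.length := Nat.sInf_le ⟨l', h1', h2', rfl⟩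
  have h4 : l.length = length l.prod := h3
  omega

/-- At least `m` letters of the word `w` can be covered by `k` increasing subwords; the letter `a` is
put into the subword with index `f a`, or left out if `k ≤ f a`. -/
def CoveredBy (k m : ℕ) (w : List ℕ) : Prop :=
  ∃ f : ℕ → ℕ, w.Pairwise (fun a b => f a < k → f a = f b → a < b) ∧
    m ≤ w.countP (fun a => f a < k)

/-! ### Coverings by increasing subwords -/

theorem pairwise_append_triple {R : ℕ → ℕ → Prop} {u v : List ℕ} {p q r : ℕ} :
    (u ++ [p, q, r] ++ v).Pairwise R ↔
      (u.Pairwise R ∧ v.Pairwise R ∧ ∀ a ∈ u, ∀ b ∈ v, R a b) ∧ (R p q ∧ R p r ∧ R q r) ∧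
      (∀ a ∈ u, R a p ∧ R a q ∧ R a r) ∧ ∀ b ∈ v, R p b ∧ R q b ∧ R r b := by
  simp only [List.pairwise_append, List.pairwise_cons, List.mem_append, List.mem_cons,
    List.not_mem_nil, or_false, or_imp, forall_and, forall_eq, List.Pairwise.nil,
    false_imp_iff, implies_true, and_true]
  tauto

theorem CoveredBy.swap {k m a b : ℕ} (hab : a < b) {u v : List ℕ}
    (h : CoveredBy k m (u ++ [b, a] ++ v)) : CoveredBy k m (u ++ [a, b] ++ v) := by
  obtain ⟨f, h1, h2⟩ := h
  refine ⟨f, ?_, h2.trans (List.Perm.countP_eq _ ?_).le⟩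
  · simp only [List.pairwise_append, List.pairwise_cons, List.mem_append, List.mem_cons,
      List.not_mem_nil, or_false, or_imp, forall_and, forall_eq] at h1 ⊢
    have hba : f a < k → f a = f b → a < b := fun _ _ => hab
    tauto
  · exact (((List.Perm.swap a b []).append_left u).append_right v)

/-- Only a subword using `x` and then `z` is destroyed. Let it be `A x z A'`, and let `B y B'` be
the subword through `y`. Replace them by `B y z A'` and `A x B'`, which are increasing since `x < y
< z`. If `y` was left out, `y` simply takes the place of `x`. -/
theorem CoveredBy.knuth_left {k m x y z : ℕ} (hxy : x < y) (hyz : y < z) {u v : List ℕ}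
    (hd : (u ++ [y, x, z] ++ v).Nodup) (h : CoveredBy k m (u ++ [y, x, z] ++ v)) :
    CoveredBy k m (u ++ [y, z, x] ++ v) := by
  obtain ⟨f, h1, h2⟩ := h
  rw [pairwise_append_triple] at h1
  obtain ⟨⟨h1u, h1v, h1uv⟩, ⟨hyx', hyz', hxz'⟩, hu, hv⟩ := h1
  rw [List.Nodup, pairwise_append_triple] at hd
  obtain ⟨⟨-, -, hduv⟩, -, hdu, hdv⟩ := hd
  by_cases hc : f x < k ∧ f x = f z
  -- The labels of the two subwords are exchanged on the prefix `u`, but only when `y` is used; a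
  -- label `≥ k` means "left out" and must not be spread.
  · obtain ⟨g, hg⟩ : ∃ g : ℕ → ℕ, g = fun a =>
      if a = y ∨ a = z then f x else if a = x then f y else
      if a ∈ u ∧ f y < k then (if f a = f x then f y else if f a = f y then f x else f a)
      else f a := ⟨_, rfl⟩
    have hne : f y ≠ f x := by omega
    have hgu : ∀ a ∈ u, g a = if f y < k then
        (if f a = f x then f y else if f a = f y then f x else f a) else f a := by
      intro a ha
      have := hdu a ha
      simp [hg, ha, this]
    have hgv : ∀ a ∈ v, g a = f a := by
      intro a ha
      have h3 := hdv a ha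
      have h4 : a ∉ u := fun h => hduv a h a ha rfl
      simp [hg, h4, h3.1.symm, h3.2.1.symm, h3.2.2.symm]
    have hgx : g x = f y := by simp [hg, hxy.ne, (hxy.trans hyz).ne]
    have hgy : g y = f x := by simp [hg]
    have hgz : g z = f x := by simp [hg]
    have hgu' : ∀ a ∈ u, (g a < k ↔ f a < k) := by
      intro a ha
      rw [hgu a ha]
      split_ifs <;> omega
    clear hg
    refine ⟨g, ?_, h2.trans (le_of_eq ?_)⟩
    · rw [pairwise_append_triple, hgx, hgy, hgz]
      refine ⟨⟨?_, ?_, ?_⟩, ?_, ?_, ?_⟩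
      · refine List.Pairwise.imp_of_mem ?_ h1u
        intro a b ha hb hab
        rw [hgu' a ha, hgu a ha, hgu b hb]
        split_ifs <;> omega
      · refine List.Pairwise.imp_of_mem ?_ h1v
        intro a b ha hb hab
        rwa [hgv a ha, hgv b hb]
      · intro a ha b hb
        have h5 := h1uv a ha b hb
        have h6 := hu a ha
        have h7 := hv b hb
        rw [hgu a ha, hgv b hb]
        split_ifs <;> omega
      · omega
      · intro a ha
        have h6 := hu a ha
        rw [hgu a ha]
        split_ifs <;> omega
      · intro b hb
        have h7 := hv b hb
        rw [hgv b hb]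
        omega
    · have e1 : u.countP (fun a => g a < k) = u.countP (fun a => f a < k) :=
        List.countP_congr (by simpa using hgu')
      have e2 : v.countP (fun a => g a < k) = v.countP (fun a => f a < k) :=
        List.countP_congr (by simp +contextual [hgv])
      simp only [List.countP_append, List.countP_cons, List.countP_nil, e1, e2, hgx, hgy, hgz,
        ← hc.2]
      ring
  · refine ⟨f, ?_, h2.trans (List.Perm.countP_eq _ ?_).le⟩
    · rw [pairwise_append_triple]
      exact ⟨⟨h1u, h1v, h1uv⟩, by omega, fun a ha => (hu a ha).imp_right And.symm,
        fun b hb => (hv b hb).imp_right And.symm⟩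
    · exact ((((List.Perm.swap z x []).cons y).append_left u).append_right v)

/-- Mirror image of the previous exchange: `A x z A'` and `B y B'` become `A x y B'` and `B z A'`,
so now the labels are exchanged on the suffix `v`. If `y` was left out, it takes the place of `z`.
-/
theorem CoveredBy.knuth_right {k m x y z : ℕ} (hxy : x < y) (hyz : y < z) {u v : List ℕ}
    (hd : (u ++ [x, z, y] ++ v).Nodup) (h : CoveredBy k m (u ++ [x, z, y] ++ v)) :
    CoveredBy k m (u ++ [z, x, y] ++ v) := by
  obtain ⟨f, h1, h2⟩ := h
  rw [pairwise_append_triple] at h1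
  obtain ⟨⟨h1u, h1v, h1uv⟩, ⟨hxz', hxy', hzy'⟩, hu, hv⟩ := h1
  rw [List.Nodup, pairwise_append_triple] at hd
  obtain ⟨⟨-, -, hduv⟩, -, hdu, hdv⟩ := hd
  by_cases hc : f x < k ∧ f x = f z
  · obtain ⟨g, hg⟩ : ∃ g : ℕ → ℕ, g = fun a =>
      if a = y ∨ a = x then f x else if a = z then f y else
      if a ∈ v ∧ f y < k then (if f a = f x then f y else if f a = f y then f x else f a)
      else f a := ⟨_, rfl⟩
    have hne : f y ≠ f x := by omega
    have hgv : ∀ a ∈ v, g a = if f y < k then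
        (if f a = f x then f y else if f a = f y then f x else f a) else f a := by
      intro a ha
      have h3 := hdv a ha
      simp [hg, ha, h3.1.symm, h3.2.1.symm, h3.2.2.symm]
    have hgu : ∀ a ∈ u, g a = f a := by
      intro a ha
      have h3 := hdu a ha
      have h4 : a ∉ v := fun h => hduv a ha a h rfl
      simp [hg, h4, h3]
    have hgz : g z = f y := by simp [hg, hyz.ne', (hxy.trans hyz).ne']
    have hgy : g y = f x := by simp [hg]
    have hgx : g x = f x := by simp [hg]
    have hgv' : ∀ a ∈ v, (g a < k ↔ f a < k) := by
      intro a ha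
      rw [hgv a ha]
      split_ifs <;> omega
    clear hg
    refine ⟨g, ?_, h2.trans (le_of_eq ?_)⟩
    · rw [pairwise_append_triple, hgx, hgy, hgz]
      refine ⟨⟨?_, ?_, ?_⟩, ?_, ?_, ?_⟩
      · refine List.Pairwise.imp_of_mem ?_ h1u
        intro a b ha hb hab
        rwa [hgu a ha, hgu b hb]
      · refine List.Pairwise.imp_of_mem ?_ h1v
        intro a b ha hb hab
        rw [hgv' a ha, hgv a ha, hgv b hb]
        split_ifs <;> omega
      · intro a ha b hb
        have h5 := h1uv a ha b hb
        have h6 := hu a ha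
        have h7 := hv b hb
        rw [hgu a ha, hgv b hb]
        split_ifs <;> omega
      · omega
      · intro a ha
        have h6 := hu a ha
        rw [hgu a ha]
        omega
      · intro b hb
        have h7 := hv b hb
        rw [hgv b hb]
        split_ifs <;> omega
    · have e1 : v.countP (fun a => g a < k) = v.countP (fun a => f a < k) :=
        List.countP_congr (by simpa using hgv')
      have e2 : u.countP (fun a => g a < k) = u.countP (fun a => f a < k) :=
        List.countP_congr (by simp +contextual [hgu])
      simp only [List.countP_append, List.countP_cons, List.countP_nil, e1, e2, hgx, hgy, hgz,
        ← hc.2]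
      ring
  · refine ⟨f, ?_, h2.trans (List.Perm.countP_eq _ ?_).le⟩
    · rw [pairwise_append_triple]
      exact ⟨⟨h1u, h1v, h1uv⟩, by omega, fun a ha => by have := hu a ha; tauto,
        fun b hb => by have := hv b hb; tauto⟩
    · exact (((List.Perm.swap z x [y]).append_left u).append_right v)

/-- The two words are rearrangements of each other, and are covered equally well by increasing
subwords within every larger word without repeated letters. -/
def GreeneEquiv (w w' : List ℕ) : Prop :=
  w.Perm w' ∧ ∀ (u v : List ℕ) (k m : ℕ), (u ++ w ++ v).Nodup →
    (CoveredBy k m (u ++ w ++ v) ↔ CoveredBy k m (u ++ w' ++ v))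

theorem GreeneEquiv.refl (w : List ℕ) : GreeneEquiv w w := ⟨List.Perm.refl w, by simp⟩

theorem GreeneEquiv.trans {w w' w'' : List ℕ} (h : GreeneEquiv w w') (h' : GreeneEquiv w' w'') :
    GreeneEquiv w w'' :=
  ⟨h.1.trans h'.1, fun u v k m hd => (h.2 u v k m hd).trans
    (h'.2 u v k m (((h.1.append_left u).append_right v).nodup_iff.1 hd))⟩

theorem GreeneEquiv.append {w w' : List ℕ} (h : GreeneEquiv w w') (p q : List ℕ) :
    GreeneEquiv (p ++ w ++ q) (p ++ w' ++ q) := by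
  refine ⟨(h.1.append_left p).append_right q, fun u v k m hd => ?_⟩
  have := h.2 (u ++ p) (q ++ v) k m (by simpa using hd)
  simpa using this

theorem greeneEquiv_left {x y z : ℕ} (hxy : x < y) (hyz : y < z) :
    GreeneEquiv [y, z, x] [y, x, z] := by
  have hp : [y, z, x].Perm [y, x, z] := (List.Perm.swap x z []).cons y
  refine ⟨hp, fun u v k m hd => ⟨fun h => ?_, fun h => ?_⟩⟩
  · have := CoveredBy.swap (hxy.trans hyz) (u := u ++ [y]) (v := v) (k := k) (m := m)
      (by simpa using h)
    simpa using this
  · exact h.knuth_left hxy hyz (((hp.append_left u).append_right v).nodup_iff.1 hd)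

theorem greeneEquiv_right {x y z : ℕ} (hxy : x < y) (hyz : y < z) :
    GreeneEquiv [x, z, y] [z, x, y] := by
  have hp : [x, z, y].Perm [z, x, y] := List.Perm.swap z x [y]
  refine ⟨hp, fun u v k m hd => ⟨fun h => ?_, fun h => ?_⟩⟩
  · exact h.knuth_right hxy hyz hd
  · have := CoveredBy.swap (hxy.trans hyz) (u := u) (v := y :: v) (k := k) (m := m)
      (by simpa using h)
    simpa using this

/-! ### Row insertion and reading words -/

/-- The row reading word of a tableau: its rows, from the bottom to the top. -/
def reading : Tableau → List ℕ
  | [] => []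
  | r :: T => reading T ++ r

/-- The tableau obtained from `T` by inserting the letters of a word one after the other. -/
def insertWord (T : Tableau) (w : List ℕ) : Tableau := w.foldl (fun T a => (insert a T).1) T

theorem rowInsert_eq_none {a : ℕ} : ∀ {r r' : List ℕ}, rowInsert a r = (r', none) → r' = r ++ [a]
  | [], r', h => by simp [rowInsert] at h; simp [← h]
  | c :: r, r', h => by
    rw [rowInsert] at h
    split_ifs at h with hac
    · simp at h
    · simp only [Prod.mk.injEq] at h
      have := rowInsert_eq_none (a := a) (r := r) (Prod.ext rfl h.2)
      simp [← h.1, this]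

/-- The head `e < b` of the new row is the witness needed for the second Knuth relation when `b`
moves left, and for column strictness when `b` opens a new row. -/
theorem rowInsert_eq_some {a b : ℕ} : ∀ {r r' : List ℕ}, r.Pairwise (· < ·) → a ∉ r →
    rowInsert a r = (r', some b) →
      r'.Pairwise (· < ·) ∧ (∀ x ∈ r', x = a ∨ x ∈ r) ∧ a < b ∧ b ∈ r ∧
        ∃ e t, r' = e :: t ∧ e < b
  | [], r', _, _, h => by simp [rowInsert] at h
  | c :: r, r', hr, ha, h => by
    rw [List.pairwise_cons] at hr
    rw [List.mem_cons, not_or] at ha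
    rw [rowInsert] at h
    split_ifs at h with hac
    · simp only [Prod.mk.injEq, Option.some.injEq] at h
      obtain ⟨rfl, rfl⟩ := h
      refine ⟨?_, by simp +contextual, hac, by simp, a, r, rfl, hac⟩
      exact List.pairwise_cons.2 ⟨fun x hx => hac.trans (hr.1 x hx), hr.2⟩
    · simp only [Prod.mk.injEq] at h
      obtain ⟨h1, h2, h3, h4, e, t, h5, h6⟩ :=
        rowInsert_eq_some (a := a) (r := r) hr.2 ha.2 (Prod.ext rfl h.2)
      rw [← h.1]
      refine ⟨List.pairwise_cons.2 ⟨fun x hx => ?_, h1⟩, ?_, h3, by simp [h4], c, _, rfl,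
        hr.1 b h4⟩
      · rcases h2 x hx with rfl | hx
        · omega
        · exact hr.1 x hx
      · intro x hx
        rcases List.mem_cons.1 hx with rfl | hx
        · simp
        · rcases h2 x hx with rfl | hx <;> simp [*]

theorem greeneEquiv_cons_append {a c : ℕ} (hac : a < c) : ∀ {r : List ℕ},
    (c :: r).Pairwise (· < ·) → GreeneEquiv (c :: r ++ [a]) (c :: a :: r)
  | [], _ => GreeneEquiv.refl _
  | d :: r, hr => by
    rw [List.pairwise_cons] at hr
    have hcd : c < d := hr.1 d (by simp)
    have h1 := (greeneEquiv_cons_append (hac.trans hcd) hr.2).append [c] []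
    have h2 := (greeneEquiv_left hac hcd).append [] r
    simp only [List.nil_append, List.append_nil, List.cons_append] at h1 h2 ⊢
    exact h1.trans h2

/-- Row bumping is a sequence of Knuth moves: `a` travels left to its place next to `b`, by the
first relation, and then `b` travels left to the front, by the second. -/
theorem greeneEquiv_rowInsert {a b : ℕ} : ∀ {r r' : List ℕ}, r.Pairwise (· < ·) → a ∉ r →
    rowInsert a r = (r', some b) → GreeneEquiv (r ++ [a]) (b :: r')
  | [], r', _, _, h => by simp [rowInsert] at h
  | c :: r, r', hr, ha, h => by
    rw [List.mem_cons, not_or] at ha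
    rw [rowInsert] at h
    split_ifs at h with hac
    · simp only [Prod.mk.injEq, Option.some.injEq] at h
      obtain ⟨rfl, rfl⟩ := h
      exact greeneEquiv_cons_append hac hr
    · simp only [Prod.mk.injEq] at h
      rw [List.pairwise_cons] at hr
      have hi : rowInsert a r = ((rowInsert a r).1, some b) := Prod.ext rfl h.2
      obtain ⟨-, h2, -, -, e, t, h5, h6⟩ := rowInsert_eq_some hr.2 ha.2 hi
      have h7 := (greeneEquiv_rowInsert hr.2 ha.2 hi).append [c] []
      have hce : c < e := by
        rcases h2 e (by simp [h5]) with rfl | he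
        · omega
        · exact hr.1 e he
      have h8 := (greeneEquiv_right hce h6).append [] t
      rw [← h.1]
      rw [h5] at h7 ⊢
      simp only [List.nil_append, List.append_nil, List.cons_append] at h7 h8 ⊢
      exact h7.trans h8

/-- The row `s` can be placed under the row `r` so that the columns increase. -/
def ColLT : List ℕ → List ℕ → Prop
  | _, [] => True
  | [], _ :: _ => False
  | a :: r, b :: s => a < b ∧ ColLT r s

theorem ColLT.append (l : List ℕ) : ∀ {r s : List ℕ}, ColLT r s → ColLT (r ++ l) s
  | _, [], _ => by simp [ColLT]
  | [], _ :: _, h => by simp [ColLT] at h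
  | a :: r, b :: s, h => ⟨h.1, ColLT.append l h.2⟩

theorem ColLT.tail : ∀ {r s : List ℕ}, ColLT r s → ColLT r.tail s.tail
  | _, [], _ => by simp [ColLT]
  | [], _ :: _, h => by simp [ColLT] at h
  | a :: r, b :: s, h => h.2

theorem ColLT.rowInsert_left {a b : ℕ} : ∀ {r r' s : List ℕ}, ColLT r s →
    rowInsert a r = (r', some b) → ColLT r' s
  | _, _, [], _, _ => by simp [ColLT]
  | [], _, _ :: _, h, _ => by simp [ColLT] at h
  | c :: r, r', d :: s, h, hi => by
    rw [rowInsert] at hi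
    split_ifs at hi with hac
    · simp only [Prod.mk.injEq] at hi
      rw [← hi.1]
      exact ⟨hac.trans h.1, h.2⟩
    · simp only [Prod.mk.injEq] at hi
      rw [← hi.1]
      exact ⟨h.1, ColLT.rowInsert_left (a := a) (b := b) h.2 (Prod.ext rfl hi.2)⟩

/-- The entry of `s` below `b`, if any, exceeds `b`, so `b` lands weakly to the left of the column
it came from, where the entries of `r'` are smaller than `b`. -/
theorem ColLT.rowInsert {a b : ℕ} : ∀ {r r' s : List ℕ}, r.Pairwise (· < ·) → a ∉ r →
    ColLT r s → rowInsert a r = (r', some b) → ColLT r' (rowInsert b s).1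
  | r, r', [], hr, ha, _, hi => by
    obtain ⟨-, -, -, -, e, t, rfl, h⟩ := rowInsert_eq_some hr ha hi
    simpa [DominanceWeakOrder.rowInsert, ColLT] using h
  | [], _, _ :: _, _, _, h, _ => by simp [ColLT] at h
  | c :: r, r', d :: s, hr, ha, h, hi => by
    rw [List.pairwise_cons] at hr
    rw [List.mem_cons, not_or] at ha
    rw [DominanceWeakOrder.rowInsert] at hi
    split_ifs at hi with hac
    · simp only [Prod.mk.injEq, Option.some.injEq] at hi
      obtain ⟨rfl, rfl⟩ := hi
      rw [DominanceWeakOrder.rowInsert, if_pos h.1]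
      exact ⟨hac, h.2⟩
    · simp only [Prod.mk.injEq] at hi
      have hi' : DominanceWeakOrder.rowInsert a r = ((DominanceWeakOrder.rowInsert a r).1, some b) :=
        Prod.ext rfl hi.2
      rw [← hi.1, DominanceWeakOrder.rowInsert]
      split_ifs with hbd
      · exact ⟨hr.1 b (rowInsert_eq_some hr.2 ha.2 hi').2.2.2.1, h.2.rowInsert_left hi'⟩
      · exact ⟨h.1, ColLT.rowInsert hr.2 ha.2 h.2 hi'⟩

/-- The rows are nonempty, and rows and columns increase strictly. -/
def IsStandard (T : Tableau) : Prop :=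
  (∀ r ∈ T, r ≠ [] ∧ r.Pairwise (· < ·)) ∧ T.IsChain ColLT

theorem greeneEquiv_insert : ∀ (a : ℕ) (T : Tableau), (∀ r ∈ T, r ≠ [] ∧ r.Pairwise (· < ·)) →
    (reading T ++ [a]).Nodup → GreeneEquiv (reading T ++ [a]) (reading (insert a T).1)
  | a, [], _, _ => GreeneEquiv.refl _
  | a, r :: T, hT, hd => by
    rw [insert]
    split
    · next r' hr =>
      rw [rowInsert_eq_none hr]
      simpa [reading] using GreeneEquiv.refl _
    · next r' b hr =>
      have hs := (hT r (by simp)).2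
      have ha : a ∉ r := by
        intro h
        exact (List.nodup_append.1 hd).2.2 a (by simp [reading, h]) a (by simp) rfl
      have h1 := (greeneEquiv_rowInsert hs ha hr).append (reading T) []
      have hd' : (reading T ++ [b] ++ r').Nodup := by
        have := h1.1.nodup_iff.1 (by simpa [reading] using hd)
        simpa using this
      have h2 := (greeneEquiv_insert b T (fun s hs => hT s (by simp [hs]))
        (List.nodup_append.1 hd').1).append [] r'
      simp only [reading, List.nil_append, List.append_nil, List.append_assoc,
        List.cons_append] at h1 h2 ⊢
      exact h1.trans h2

theorem IsStandard.insert : ∀ {a : ℕ} {T : Tableau}, IsStandard T → (reading T ++ [a]).Nodup →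
    IsStandard (insert a T).1
  | a, [], _, _ => by simp [DominanceWeakOrder.insert, IsStandard]
  | a, r :: T, hT, hd => by
    have hs := (hT.1 r (by simp)).2
    have ha : a ∉ r := by
      intro h
      exact (List.nodup_append.1 hd).2.2 a (by simp [reading, h]) a (by simp) rfl
    have hT' : IsStandard T := ⟨fun s h => hT.1 s (by simp [h]), hT.2.tail⟩
    rw [DominanceWeakOrder.insert]
    split
    · next r' hr =>
      obtain rfl := rowInsert_eq_none hr
      refine ⟨fun s h => ?_, ?_⟩
      · rcases List.mem_cons.1 h with rfl | h
        · refine ⟨by simp, List.pairwise_append.2 ⟨hs, by simp, ?_⟩⟩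
          have hle : ∀ (l l' : List ℕ), l.Pairwise (· < ·) → rowInsert a l = (l', none) →
              ∀ x ∈ l, x ≤ a := by
            intro l
            induction l with
            | nil => simp
            | cons c l ih =>
              intro l' hl hi
              rw [rowInsert] at hi
              split_ifs at hi with hac
              · simp at hi
              · simp only [Prod.mk.injEq] at hi
                have := ih _ (List.pairwise_cons.1 hl).2 (Prod.ext rfl hi.2)
                intro x hx
                rcases List.mem_cons.1 hx with rfl | hx
                · omega
                · exact this x hx
          intro x hx y hy
          obtain rfl := List.mem_singleton.1 hy
          exact lt_of_le_of_ne (hle _ _ hs hr x hx) (fun h => ha (h ▸ hx))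
        · exact hT'.1 s h
      · cases T with
        | nil => simp
        | cons s T =>
          have h := List.isChain_cons_cons.1 hT.2
          exact List.isChain_cons_cons.2 ⟨h.1.append _, h.2⟩
    · next r' b hr =>
      obtain ⟨h1, h2, h3, h4, e, t, h5, h6⟩ := rowInsert_eq_some hs ha hr
      have hd' : (reading T ++ [b]).Nodup := by
        simp only [reading, List.append_assoc] at hd
        refine List.Nodup.sublist ?_ hd
        refine (List.singleton_sublist.2 ?_).append_left _
        simp [h4]
      have ih := IsStandard.insert hT' hd'
      refine ⟨fun s h => ?_, ?_⟩
      · rcases List.mem_cons.1 h with rfl | h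
        · exact ⟨by simp [h5], h1⟩
        · exact ih.1 s h
      · cases T with
        | nil => simpa [DominanceWeakOrder.insert, h5, ColLT] using h6
        | cons s T =>
          have h := (List.isChain_cons_cons.1 hT.2).1.rowInsert hs ha hr
          have ih := ih.2
          rw [DominanceWeakOrder.insert] at ih ⊢
          split at ih
          · next s' hs' =>
            rw [hs'] at h
            exact List.isChain_cons_cons.2 ⟨h, ih⟩
          · next s' c hs' =>
            rw [hs'] at h
            exact List.isChain_cons_cons.2 ⟨h, ih⟩

theorem insertWord_append (T : Tableau) (u v : List ℕ) :
    insertWord T (u ++ v) = insertWord (insertWord T u) v := List.foldl_append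

theorem insertWord_spec (w : List ℕ) (hw : w.Nodup) :
    IsStandard (insertWord [] w) ∧ GreeneEquiv w (reading (insertWord [] w)) := by
  induction w using List.reverseRecOn with
  | nil => exact ⟨by simp [insertWord, IsStandard], GreeneEquiv.refl _⟩
  | append_singleton w a ih =>
    obtain ⟨h1, h2⟩ := ih (List.nodup_append.1 hw).1
    have h3 := h2.append [] [a]
    rw [List.nil_append, List.nil_append] at h3
    have hd := h3.1.nodup_iff.1 hw
    rw [insertWord_append]
    exact ⟨h1.insert hd, h3.trans (greeneEquiv_insert a _ h1.1 hd)⟩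

/-! ### Coverings of the reading word of a tableau -/

theorem coveredBy_reading : ∀ (k : ℕ) (T : Tableau), (∀ r ∈ T, r.Pairwise (· < ·)) →
    (reading T).Nodup → CoveredBy k (T.shape.take k).sum (reading T)
  | 0, T, _, _ => ⟨fun _ => 0, by simp [List.pairwise_iff_getElem], by simp⟩
  | k + 1, [], _, _ => ⟨fun _ => 0, by simp [reading], by simp [Tableau.shape]⟩
  | k + 1, r :: T, hT, hd => by
    obtain ⟨hd1, hd2, hd3⟩ := List.nodup_append.1 hd
    obtain ⟨f, h1, h2⟩ := coveredBy_reading k T (fun s hs => hT s (by simp [hs])) hd1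
    have hf : ∀ a ∈ reading T, a ∉ r := fun a ha h => hd3 a ha a h rfl
    -- The rows themselves are the increasing subwords: the top row gets label `0` and the labels
    -- below shift by one.
    refine ⟨fun a => if a ∈ r then 0 else f a + 1, List.pairwise_append.2 ⟨?_, ?_, ?_⟩, ?_⟩
    · refine List.Pairwise.imp_of_mem ?_ h1
      intro a b ha hb
      simp [hf a ha, hf b hb]
    · exact (hT r (by simp)).imp fun h _ _ => h
    · intro a ha b hb
      simp [hf a ha, hb]
    · have e1 : (reading T).countP (fun a => (if a ∈ r then 0 else f a + 1) < k + 1) =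
          (reading T).countP (fun a => f a < k) :=
        List.countP_congr fun a ha => by simp [hf a ha]
      have e2 : r.countP (fun a => (if a ∈ r then 0 else f a + 1) < k + 1) = r.length :=
        List.countP_eq_length.2 fun a ha => by simp [ha]
      rw [reading, List.countP_append, e1, e2]
      simp only [Tableau.shape, List.map_cons, List.take_succ_cons, List.sum_cons] at h2 ⊢
      omega

/-- The first column of a tableau. -/
def firstColumn (T : Tableau) : List ℕ := T.filterMap List.head?

@[simp] theorem firstColumn_nil : firstColumn [] = [] := rfl

@[simp] theorem firstColumn_nil_cons (T : Tableau) : firstColumn ([] :: T) = firstColumn T := rfl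

@[simp] theorem firstColumn_cons_cons (c : ℕ) (r : List ℕ) (T : Tableau) :
    firstColumn ((c :: r) :: T) = c :: firstColumn T := rfl

/-- Empty rows must be handled because columns will be peeled off by taking tails of rows; below an
empty row every row is empty. -/
theorem firstColumn_eq_nil {T : Tableau} (h : List.IsChain ColLT ([] :: T)) :
    ∀ S : Tableau, S.Sublist T → firstColumn S = [] := by
  induction T with
  | nil => intro S hS; rw [List.sublist_nil.1 hS]; rfl
  | cons s T ih =>
    obtain ⟨h1, h2⟩ := List.isChain_cons_cons.1 h
    cases s with
    | nil =>
      intro S hS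
      have : ∀ r ∈ T, r = [] := by
        intro r hr
        have := ih h2 [r] (List.singleton_sublist.2 hr)
        cases r <;> simp [firstColumn] at this ⊢
      rw [firstColumn, List.filterMap_eq_nil_iff]
      intro r hr
      rcases List.mem_cons.1 (hS.subset hr) with rfl | hr
      · rfl
      · rw [this r hr]; rfl
    | cons => simp [ColLT] at h1

theorem firstColumn_pairwise : ∀ {T : Tableau}, T.IsChain ColLT →
    (firstColumn T).Pairwise (· < ·)
  | [], _ => by simp
  | [] :: T, h => by
    have := firstColumn_eq_nil h T (List.Sublist.refl _)
    simp_all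
  | (c :: r) :: [], _ => by simp
  | (c :: r) :: [] :: T, h => by
    have := firstColumn_eq_nil h.tail T (List.Sublist.refl _)
    simp_all
  | (c :: r) :: (d :: s) :: T, h => by
    have ih := firstColumn_pairwise h.tail
    have hcd : c < d := (List.isChain_cons_cons.1 h).1.1
    simp only [List.tail_cons, firstColumn_cons_cons, List.pairwise_cons] at ih ⊢
    refine ⟨?_, ih⟩
    intro x hx
    rcases List.mem_cons.1 hx with rfl | hx
    · exact hcd
    · exact hcd.trans (ih.1 x hx)

theorem firstColumn_take : ∀ (k : ℕ) {T : Tableau}, T.IsChain ColLT →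
    firstColumn (T.take k) = (firstColumn T).take k
  | 0, _, _ => by simp
  | k + 1, [], _ => by simp
  | k + 1, [] :: T, h => by
    have h1 := firstColumn_eq_nil h T (List.Sublist.refl _)
    have h2 := firstColumn_eq_nil h _ (List.take_sublist k T)
    simp_all
  | k + 1, (c :: r) :: T, h => by
    have := firstColumn_take k h.tail
    simp_all

theorem reading_perm : ∀ T : Tableau,
    (reading T).Perm (firstColumn T ++ reading (T.map List.tail))
  | [] => List.Perm.refl _
  | [] :: T => by simpa [reading] using reading_perm T
  | (c :: r) :: T => by
    have := (reading_perm T).append_right (c :: r)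
    refine this.trans ?_
    simp only [firstColumn_cons_cons, List.map_cons, List.tail_cons,
      reading, List.cons_append, ← List.append_assoc]
    exact List.perm_middle

theorem reading_tail_sublist : ∀ T : Tableau, (reading (T.map List.tail)).Sublist (reading T)
  | [] => List.Sublist.refl _
  | r :: T => (reading_tail_sublist T).append (List.tail_sublist r)

theorem firstColumn_reverse_sublist : ∀ T : Tableau, (firstColumn T).reverse.Sublist (reading T)
  | [] => List.Sublist.refl _
  | [] :: T => by simpa [reading] using firstColumn_reverse_sublist T
  | (c :: r) :: T => by
    have := (firstColumn_reverse_sublist T).append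
      (List.singleton_sublist.2 (List.mem_cons_self (a := c) (l := r)))
    simpa [reading] using this

theorem shape_sum (T : Tableau) :
    T.shape.sum = (firstColumn T).length + (Tableau.shape (T.map List.tail)).sum := by
  induction T with
  | nil => rfl
  | cons r T ih =>
    cases r <;> simp_all [Tableau.shape]
    omega

theorem countP_le_of_pairwise_ne {k : ℕ} {f : ℕ → ℕ} {l : List ℕ}
    (h : l.Pairwise fun a b => f b < k → f b ≠ f a) : l.countP (fun a => f a < k) ≤ k := by
  have hd : ((l.filter fun a => f a < k).map f).Nodup := by
    rw [List.Nodup, List.pairwise_map]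
    refine List.Pairwise.imp_of_mem ?_ (h.filter _)
    intro a b _ hb hab
    exact (hab (by simpa using (List.mem_filter.1 hb).2)).symm
  have hs : ((l.filter fun a => f a < k).map f) ⊆ List.range k := by
    intro x hx
    obtain ⟨a, ha, rfl⟩ := List.mem_map.1 hx
    simpa using (List.mem_filter.1 ha).2
  have := (List.subperm_of_subset hd hs).length_le
  rwa [List.length_map, List.length_range, ← List.countP_eq_length_filter] at this

/-- A column read upwards is a decreasing subword, so it meets each increasing subword at most once.
A column of height `c` thus contributes at most `min k c` letters, which is its number of boxes in
the first `k` rows. The induction on `N` removes one column at a time. -/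
theorem countP_reading_le (k : ℕ) (f : ℕ → ℕ) (N : ℕ) : ∀ T : Tableau, T.IsChain ColLT →
    (∀ r ∈ T, r.length ≤ N) →
    (reading T).Pairwise (fun a b => f a < k → f a = f b → a < b) →
    (reading T).countP (fun a => f a < k) ≤ (T.shape.take k).sum := by
  induction N with
  | zero =>
    intro T _ hN _
    have h : ∀ S : Tableau, (∀ r ∈ S, r.length ≤ 0) → reading S = [] := by
      intro S hS
      induction S with
      | nil => rfl
      | cons r S ih =>
        rw [reading, ih fun s hs => hS s (by simp [hs]), List.nil_append]
        simpa using hS r (by simp)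
    simp [h T hN]
  | succ N ih =>
    intro T hT hN hf
    have ih := ih (T.map List.tail)
      ((List.isChain_map _).2 (hT.imp fun _ _ h => h.tail))
      (fun r hr => by
        obtain ⟨s, hs, rfl⟩ := List.mem_map.1 hr
        have := hN s hs
        rw [List.length_tail]; omega)
      (hf.sublist (reading_tail_sublist T))
    have h1 := List.pairwise_reverse.1 (hf.sublist (firstColumn_reverse_sublist T))
    have h2 := countP_le_of_pairwise_ne (k := k) (f := f) (l := firstColumn T)
      (((firstColumn_pairwise hT).and h1).imp fun {a b} hab hb he => by
        have := hab.2 hb he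
        omega)
    have h3 := shape_sum (T.take k)
    rw [firstColumn_take k hT, List.length_take] at h3
    have h4 : (firstColumn T).countP (fun a => f a < k) ≤ _ := List.countP_le_length
    rw [(reading_perm T).countP_eq, List.countP_append]
    simp only [Tableau.shape, ← List.map_take] at h3 ih ⊢
    omega

/-- Greene's theorem: the first `k` rows of the insertion tableau have as many boxes as there are
letters in `k` disjoint increasing subwords, at most. -/
theorem coveredBy_iff {w : List ℕ} (hw : w.Nodup) (k m : ℕ) :
    CoveredBy k m w ↔ m ≤ ((insertWord [] w).shape.take k).sum := by
  obtain ⟨h1, h2⟩ := insertWord_spec w hw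
  have h3 := h2.2 [] [] k m (by simpa using hw)
  simp only [List.nil_append, List.append_nil] at h3
  rw [h3]
  constructor
  · rintro ⟨f, hf, hm⟩
    refine hm.trans (countP_reading_le k f ((insertWord [] w).map List.length).sum _ h1.2 ?_ hf)
    intro r hr
    exact List.le_sum_of_mem (List.mem_map_of_mem hr)
  · intro hm
    obtain ⟨f, hf, hm'⟩ := coveredBy_reading k _ (fun r hr => (h1.1 r hr).2)
      (h2.1.nodup_iff.1 hw)
    exact ⟨f, hf, hm.trans hm'⟩

/-! ### Words of permutations -/

/-- The word `w(1), …, w(n)` of a permutation. -/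
def word {n : ℕ} (w : Equiv.Perm (Fin n)) : List ℕ := List.ofFn fun i => (w i : ℕ) + 1

theorem shape_Q {n : ℕ} (w : Equiv.Perm (Fin n)) :
    (Q w).shape = (insertWord [] (word w)).shape := by
  have key : ∀ (l : List (Fin n)) (PQ : Tableau × Tableau),
      (l.foldl (fun PQ i => rsStep PQ ((w i : ℕ) + 1) ((i : ℕ) + 1)) PQ).1 =
        insertWord PQ.1 (l.map fun i => (w i : ℕ) + 1) := by
    intro l
    induction l with
    | nil => intro PQ; rfl
    | cons i l ih => intro PQ; exact ih _
  rw [← shape_P_eq_shape_Q, word, List.ofFn_eq_map]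
  exact congrArg Tableau.shape (key _ _)

theorem word_nodup {n : ℕ} (w : Equiv.Perm (Fin n)) : (word w).Nodup := by
  refine List.nodup_ofFn.2 fun i j h => ?_
  simpa [Fin.val_inj] using h

theorem word_perm {n : ℕ} (x y : Equiv.Perm (Fin n)) : (word x).Perm (word y) := by
  refine (List.perm_ext_iff_of_nodup (word_nodup x) (word_nodup y)).2 fun a => ?_
  simp only [word, List.mem_ofFn]
  constructor
  · rintro ⟨i, rfl⟩
    exact ⟨y.symm (x i), by simp⟩
  · rintro ⟨i, rfl⟩
    exact ⟨x.symm (y i), by simp⟩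

theorem coveredBy_of_length_lt {n : ℕ} {u s : Equiv.Perm (Fin n)} (hs : IsSimple s)
    (h : length u < length (u * s)) {k m : ℕ} (hc : CoveredBy k m (word (u * s))) :
    CoveredBy k m (word u) := by
  obtain ⟨i, j, hij, rfl⟩ := hs
  have hlt : i < j := Fin.lt_def.2 (by omega)
  have hu : ¬ u j < u i := fun hu => absurd (length_mul_swap_lt hlt hu) h.asymm
  obtain ⟨f, h1, h2⟩ := hc
  -- Labels are attached to letters, not positions, so the same `f` serves both words.
  refine ⟨f, ?_, h2.trans ((word_perm _ _).countP_eq _).le⟩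
  rw [word, List.pairwise_ofFn] at h1 ⊢
  intro p q hpq hfp hf
  by_contra hle
  have hle' : u q < u p := lt_of_le_of_ne (Fin.le_def.2 (by omega))
    (fun e => hpq.ne' (u.injective e))
  -- A pair of positions inverted by `u` is not `(i, j)`, so the simple transposition keeps its
  -- order and the pair is also inverted in `u * s`.
  have h3 : Equiv.swap i j p < Equiv.swap i j q := by
    have : ¬ (p = i ∧ q = j) := by
      rintro ⟨rfl, rfl⟩
      exact hu hle'
    rw [Equiv.swap_apply_def, Equiv.swap_apply_def]
    simp only [Fin.ext_iff, Fin.lt_def] at *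
    split_ifs <;> omega
  have h4 := h1 h3
  simp only [Equiv.Perm.mul_apply, Equiv.swap_apply_self] at h4
  exact hle (h4 hfp hf)

theorem coveredBy_of_weakLE {n k m : ℕ} {x y : Equiv.Perm (Fin n)} (h : WeakLE y x) :
    CoveredBy k m (word x) → CoveredBy k m (word y) := by
  induction h with
  | refl => exact id
  | tail _ huv ih =>
    obtain ⟨s, hs, rfl, hl⟩ := huv
    exact fun h => ih (coveredBy_of_length_lt hs hl h)

/-- Going down in the weak order goes up in the dominance order. -/
theorem domLE_of_weakLE {n : ℕ} {a b : n.Partition} {x y : Equiv.Perm (Fin n)} (hx : x ∈ J a)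
    (hy : y ∈ J b) (h : WeakLE y x) : DomLE a b := by
  intro k
  rw [← show (Q x).shape = sortedParts a from hx, ← show (Q y).shape = sortedParts b from hy,
    shape_Q, shape_Q, ← coveredBy_iff (word_nodup y)]
  exact coveredBy_of_weakLE h ((coveredBy_iff (word_nodup x) _ _).2 le_rfl)

theorem exists_word_eq {n : ℕ} {l : List ℕ} (h : l.Perm (List.range' 1 n)) :
    ∃ w : Equiv.Perm (Fin n), word w = l := by
  have hl : l.length = n := by simpa using h.length_eq
  have hd : l.Nodup := h.nodup_iff.2 List.nodup_range'
  have hm : ∀ x ∈ l, 1 ≤ x ∧ x < 1 + n := fun x hx => by simpa using h.mem_iff.1 hx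
  let f : Fin n → Fin n := fun i => ⟨l[i.1]'(by omega) - 1, by
    have := hm _ (List.getElem_mem (h := (by omega : i.1 < l.length))); omega⟩
  have hf : Function.Injective f := by
    intro i j hij
    have h1 := hm _ (List.getElem_mem (h := (by omega : i.1 < l.length)))
    have h2 := hm _ (List.getElem_mem (h := (by omega : j.1 < l.length)))
    have h3 : l[i.1]'(by omega) - 1 = l[j.1]'(by omega) - 1 := congrArg Fin.val hij
    exact Fin.ext ((hd.getElem_inj_iff).1 (by omega))
  refine ⟨Equiv.ofBijective f (Finite.injective_iff_bijective.1 hf), ?_⟩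
  refine List.ext_getElem (by simp [word, hl]) fun i h1 h2 => ?_
  have := hm _ (List.getElem_mem h2)
  simp only [word, List.getElem_ofFn, Equiv.ofBijective_apply, f]
  omega

theorem word_mul_swap {n : ℕ} {w : Equiv.Perm (Fin n)} {u v : List ℕ} {a b : ℕ}
    (h : word w = u ++ [b, a] ++ v) (hab : a < b) :
    ∃ i j : Fin n, (i : ℕ) + 1 = j ∧ w j < w i ∧
      word (w * Equiv.swap i j) = u ++ [a, b] ++ v := by
  have hn : n = u.length + v.length + 2 := by
    have := congrArg List.length h
    simp [word] at this
    omega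
  have hget : ∀ i : Fin n, (w i : ℕ) + 1 = (u ++ [b, a] ++ v)[i.1]'(by simp; omega) := by
    intro i
    simp only [← h, word, List.getElem_ofFn]
  have hi : u.length < n := by omega
  have hj : u.length + 1 < n := by omega
  have h1 : (w ⟨_, hi⟩ : ℕ) + 1 = b := by rw [hget]; simp
  have h2 : (w ⟨_, hj⟩ : ℕ) + 1 = a := by rw [hget]; simp
  refine ⟨⟨_, hi⟩, ⟨_, hj⟩, rfl, Fin.lt_def.2 (by omega), ?_⟩
  refine List.ext_getElem (by simp [word]; omega) fun k hk hk' => ?_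
  have hk2 : k < n := by simpa [word] using hk
  simp only [word, List.getElem_ofFn, Equiv.Perm.mul_apply]
  rw [Equiv.swap_apply_def]
  split_ifs with e1 e2
  · obtain rfl : k = u.length := congrArg Fin.val e1
    rw [h2]; simp
  · obtain rfl : k = u.length + 1 := congrArg Fin.val e2
    rw [h1]; simp
  · rw [hget]
    simp only [Fin.mk.injEq] at e1 e2
    simp only [List.append_assoc, List.getElem_append, List.cons_append, List.nil_append,
      List.getElem_cons]
    split_ifs <;> first | rfl | omega

/-! ### Inserting words into tableaux -/

theorem rowInsert_mem {a b : ℕ} : ∀ {r : List ℕ}, (rowInsert a r).2 = some b → b ∈ r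
  | [], h => by simp [rowInsert] at h
  | c :: r, h => by
    rw [rowInsert] at h
    split_ifs at h with hac
    · simp_all
    · exact List.mem_cons_of_mem _ (rowInsert_mem h)

theorem mem_rowInsert {a x : ℕ} : ∀ {r : List ℕ}, x ∈ (rowInsert a r).1 → x = a ∨ x ∈ r
  | [], h => by simpa [rowInsert] using h
  | c :: r, h => by
    rw [rowInsert] at h
    split_ifs at h with hac
    · rcases List.mem_cons.1 h with rfl | h <;> simp [*]
    · rcases List.mem_cons.1 h with rfl | h
      · simp
      · rcases mem_rowInsert h with h | h <;> simp [h]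

theorem mem_insert {x : ℕ} : ∀ {a : ℕ} {T : Tableau}, x ∈ (insert a T).1.flatten →
    x = a ∨ x ∈ T.flatten
  | a, [], h => by simpa [insert] using h
  | a, r :: T, h => by
    rw [insert] at h
    split at h
    · next r' hr =>
      rw [List.flatten_cons, List.mem_append] at h ⊢
      rcases h with h | h
      · rcases mem_rowInsert (a := a) (r := r) (by rwa [hr]) with h | h <;> simp [h]
      · simp [h]
    · next r' b hr =>
      rw [List.flatten_cons, List.mem_append] at h ⊢
      rcases h with h | h
      · rcases mem_rowInsert (a := a) (r := r) (by rwa [hr]) with h | h <;> simp [h]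
      · rcases mem_insert h with rfl | h
        · exact .inr (.inl (rowInsert_mem (a := a) (by rw [hr])))
        · exact .inr (.inr h)

/-- Two tableaux placed side by side, with the rows concatenated. -/
def join : Tableau → Tableau → Tableau
  | [], U => U
  | T, [] => T
  | r :: T, s :: U => (r ++ s) :: join T U

theorem join_nil (T : Tableau) : join T [] = T := by cases T <;> rfl

theorem shape_join : ∀ (T U : Tableau) (i : ℕ),
    (join T U).shape.getD i 0 = T.shape.getD i 0 + U.shape.getD i 0
  | [], U, i => by simp [join, Tableau.shape]
  | r :: T, [], i => by simp [join, Tableau.shape]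
  | r :: T, s :: U, 0 => by simp [join, Tableau.shape]
  | r :: T, s :: U, i + 1 => by simpa [join, Tableau.shape] using shape_join T U i

theorem rowInsert_append {a : ℕ} {s : List ℕ} : ∀ {r : List ℕ}, (∀ x ∈ r, x ≤ a) →
    rowInsert a (r ++ s) = (r ++ (rowInsert a s).1, (rowInsert a s).2)
  | [], _ => rfl
  | c :: r, h => by
    have := h c (by simp)
    rw [List.cons_append, rowInsert, if_neg (by omega),
      rowInsert_append fun x hx => h x (by simp [hx])]
    rfl

/-- A letter above `M` passes over the entries of `T` in each row and can bump only an entry of `U`,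
which is again above `M`. -/
theorem insert_join {M : ℕ} : ∀ {a : ℕ} {T U : Tableau}, (∀ x ∈ T.flatten, x ≤ M) →
    (∀ x ∈ U.flatten, M < x) → M < a → (insert a (join T U)).1 = join T (insert a U).1
  | a, [], U, _, _, _ => rfl
  | a, r :: T, [], hT, _, ha => by
    have : rowInsert a r = (r ++ [a], none) := by
      have := rowInsert_append (a := a) (s := []) (r := r)
        fun x hx => (hT x (by simp [hx])).trans ha.le
      simpa [rowInsert] using this
    simp [join, insert, this, join_nil]
  | a, r :: T, s :: U, hT, hU, ha => by
    have := rowInsert_append (a := a) (s := s) (r := r)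
      fun x hx => (hT x (by simp [hx])).trans ha.le
    rcases hs : rowInsert a s with ⟨s', _ | b⟩
    · simp [join, insert, this, hs]
    · have hb : M < b := hU b (by simp [rowInsert_mem (a := a) (r := s) (by rw [hs])])
      have ih := insert_join (a := b) (T := T) (U := U)
        (fun x hx => hT x (by simp only [List.flatten_cons, List.mem_append, hx, or_true]))
        (fun x hx => hU x (by simp only [List.flatten_cons, List.mem_append, hx, or_true])) hb
      simp [join, insert, this, hs, ih]

theorem insertWord_join {M : ℕ} {T : Tableau} (hT : ∀ x ∈ T.flatten, x ≤ M) :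
    ∀ {w : List ℕ} {U : Tableau}, (∀ x ∈ U.flatten, M < x) → (∀ a ∈ w, M < a) →
      insertWord (join T U) w = join T (insertWord U w)
  | [], _, _, _ => rfl
  | a :: w, U, hU, hw => by
    have ha := hw a (by simp)
    have := insertWord_join hT (w := w) (U := (insert a U).1)
      (fun x hx => by
        rcases mem_insert hx with rfl | hx
        · exact ha
        · exact hU x hx)
      fun b hb => hw b (by simp [hb])
    rw [← insert_join hT hU ha] at this
    exact this

theorem mem_insertWord {x : ℕ} : ∀ {w : List ℕ} {T : Tableau}, x ∈ (insertWord T w).flatten →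
    x ∈ w ∨ x ∈ T.flatten
  | [], _, h => .inr h
  | a :: w, T, h => by
    rcases mem_insertWord (w := w) (T := (insert a T).1) h with h | h
    · simp [h]
    · rcases mem_insert h with rfl | h
      · simp
      · exact .inr h

/-- If the letters of `v` are larger than those of `u`, the row lengths of the insertion tableau
of `u v` are the sums of those for `u` and for `v`. -/
theorem shape_insertWord_append {M : ℕ} {u v : List ℕ} (hu : ∀ a ∈ u, a ≤ M)
    (hv : ∀ a ∈ v, M < a) (i : ℕ) : (insertWord [] (u ++ v)).shape.getD i 0 =
      (insertWord [] u).shape.getD i 0 + (insertWord [] v).shape.getD i 0 := by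
  rw [insertWord_append, ← shape_join, ← insertWord_join (M := M) _ (by simp) hv, join_nil]
  intro x hx
  rcases mem_insertWord hx with h | h
  · exact hu x h
  · simp at h

/-! ### Words with two-column tableaux -/

/-- The word `lo + 2b - 1, lo + 2b, …, lo + 3, lo + 4, lo + 1, lo + 2`. -/
def pairWord : ℕ → ℕ → List ℕ
  | _, 0 => []
  | lo, b + 1 => pairWord (lo + 2) b ++ [lo + 1, lo + 2]

/-- The tableau with the `b` rows `lo + 1, lo + 2` and `lo + 3, lo + 4` and so on. -/
def pairRows : ℕ → ℕ → Tableau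
  | _, 0 => []
  | lo, b + 1 => [lo + 1, lo + 2] :: pairRows (lo + 2) b

/-- The word `lo + t, …, lo + 1`. -/
def descWord : ℕ → ℕ → List ℕ
  | _, 0 => []
  | lo, t + 1 => (lo + t + 1) :: descWord lo t

/-- The pair `c, d` bumps the whole top row, which in turn bumps the next one, so the stack moves
down by one row. -/
theorem insert_insert_pairRows {c d : ℕ} (hcd : c < d) : ∀ {b lo : ℕ}, d ≤ lo →
    (insert d (insert c (pairRows lo b)).1).1 = [c, d] :: pairRows lo b
  | 0, lo, _ => by simp [pairRows, insert, rowInsert, hcd.not_gt]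
  | b + 1, lo, hd => by
    have ih := insert_insert_pairRows (c := lo + 1) (d := lo + 2) (by omega) (b := b) le_rfl
    have h1 : c < lo + 1 := by omega
    have h2 : d < lo + 2 := by omega
    simp [pairRows, insert, rowInsert, h1, h2, hcd.not_gt, ih]

theorem insertWord_pairWord : ∀ lo b : ℕ, insertWord [] (pairWord lo b) = pairRows lo b
  | _, 0 => rfl
  | lo, b + 1 => by
    rw [pairWord, insertWord_append, insertWord_pairWord]
    exact insert_insert_pairRows (by omega) le_rfl

theorem firstColumn_pairRows : ∀ {lo b : ℕ}, (firstColumn (pairRows lo b)).Pairwise (· < ·) ∧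
    ∀ x ∈ firstColumn (pairRows lo b), lo < x
  | _, 0 => by simp [pairRows]
  | lo, b + 1 => by
    obtain ⟨h1, h2⟩ := firstColumn_pairRows (lo := lo + 2) (b := b)
    simp only [pairRows, firstColumn_cons_cons, List.pairwise_cons, List.mem_cons]
    refine ⟨⟨fun x hx => ?_, h1⟩, ?_⟩
    · have := h2 x hx; omega
    · rintro x (rfl | hx)
      · omega
      · have := h2 x hx; omega

theorem shape_pairRows : ∀ lo b : ℕ, (pairRows lo b).shape = List.replicate b 2
  | _, 0 => rfl
  | lo, b + 1 => by
    simpa [pairRows, Tableau.shape, List.replicate_succ] using shape_pairRows (lo + 2) b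

/-- All bumping takes place in the first column, which moves down by one box. -/
theorem insert_of_lt_firstColumn : ∀ {a : ℕ} {T : Tableau}, 0 ∉ T.shape →
    (a :: firstColumn T).Pairwise (· < ·) →
    (insert a T).1.shape = T.shape ++ [1] ∧ firstColumn (insert a T).1 = a :: firstColumn T
  | a, [], _, _ => by simp [insert, Tableau.shape]
  | a, [] :: T, h, _ => by simp [Tableau.shape] at h
  | a, (c :: r) :: T, h, hc => by
    rw [firstColumn_cons_cons, List.pairwise_cons] at hc
    have hac := hc.1 c (by simp)
    have ih := insert_of_lt_firstColumn (a := c) (T := T)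
      (by simp [Tableau.shape] at h ⊢; exact h) hc.2
    simp_all [insert, rowInsert, Tableau.shape]

theorem shape_insertWord_descWord {lo : ℕ} : ∀ {t : ℕ} {T : Tableau}, 0 ∉ T.shape →
    (firstColumn T).Pairwise (· < ·) → (∀ x ∈ firstColumn T, lo + t < x) →
    (insertWord T (descWord lo t)).shape = T.shape ++ List.replicate t 1
  | 0, T, _, _, _ => by simp [descWord, insertWord]
  | t + 1, T, h0, h1, h2 => by
    obtain ⟨h3, h4⟩ := insert_of_lt_firstColumn (a := lo + t + 1) h0
      (List.pairwise_cons.2 ⟨h2, h1⟩)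
    have := shape_insertWord_descWord (lo := lo) (t := t) (T := (insert (lo + t + 1) T).1) (by simp [h3, h0])
      (by rw [h4]; exact List.pairwise_cons.2 ⟨h2, h1⟩)
      (by
        rw [h4]
        intro x hx
        rcases List.mem_cons.1 hx with rfl | hx
        · omega
        · have := h2 x hx; omega)
    rw [h3] at this
    simpa [descWord, insertWord, List.replicate_succ] using this

theorem shape_pairWord_descWord (lo t b i : ℕ) :
    (insertWord [] (pairWord (lo + t) b ++ descWord lo t)).shape.getD i 0 =
      (if i < b then 1 else 0) + if i < b + t then 1 else 0 := by
  rw [insertWord_append, insertWord_pairWord, shape_insertWord_descWord (by simp [shape_pairRows])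
    firstColumn_pairRows.1 firstColumn_pairRows.2, shape_pairRows]
  simp only [List.getD_eq_getElem?_getD, List.getElem?_append, List.length_replicate,
    List.getElem?_replicate]
  split_ifs <;> first | rfl | omega

theorem descWord_perm : ∀ lo t : ℕ, (descWord lo t).Perm (List.range' (lo + 1) t)
  | _, 0 => List.Perm.refl _
  | lo, t + 1 => by
    have := ((descWord_perm lo t).cons (lo + t + 1)).trans (List.perm_append_singleton _ _).symm
    rw [List.range'_concat]
    simpa [descWord, add_right_comm] using this

theorem pairWord_perm : ∀ lo b : ℕ, (pairWord lo b).Perm (List.range' (lo + 1) (2 * b))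
  | _, 0 => List.Perm.refl _
  | lo, b + 1 => by
    have := ((pairWord_perm (lo + 2) b).append_right [lo + 1, lo + 2]).trans List.perm_append_comm
    simpa [pairWord, mul_add, List.range'_succ] using this

theorem pairWord_append_descWord_perm (lo t b : ℕ) :
    (pairWord (lo + t) b ++ descWord lo t).Perm (List.range' (lo + 1) (t + 2 * b)) := by
  have := ((pairWord_perm (lo + t) b).append (descWord_perm lo t)).trans List.perm_append_comm
  rwa [add_right_comm, List.range'_append_1] at this

/-- Every weakly decreasing sequence of row lengths occurs for some word in `1, …, m`. -/
theorem exists_word_shape (N : ℕ) : ∀ R : ℕ → ℕ, Antitone R → (∃ L, R L = 0) → R 0 ≤ N →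
    ∃ (m : ℕ) (w : List ℕ), w.Perm (List.range' 1 m) ∧
      ∀ i, (insertWord [] w).shape.getD i 0 = R i := by
  induction N with
  | zero =>
    intro R hR _ h0
    refine ⟨0, [], List.Perm.refl _, fun i => ?_⟩
    have := hR (Nat.zero_le i)
    simp [insertWord, Tableau.shape]
    omega
  | succ N ih =>
    intro R hR hL h0
    classical
    obtain ⟨m, w, hw, hs⟩ := ih (fun i => R i - 1) (fun i j hij => Nat.sub_le_sub_right (hR hij) 1)
      (hL.imp fun L h => by simp [h]) (by omega)
    -- `Nat.find hL` is the number of nonzero rows, that is, the height of the first column; a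
    -- decreasing run of larger letters supplies that column.
    refine ⟨m + Nat.find hL, w ++ descWord m (Nat.find hL), ?_, fun i => ?_⟩
    · have := hw.append (descWord_perm m (Nat.find hL))
      rwa [add_comm m 1, List.range'_append_1] at this
    · have h1 := shape_pairWord_descWord m (Nat.find hL) 0 i
      rw [shape_insertWord_append (M := m)
        (fun a ha => by have := List.mem_range'_1.1 (hw.mem_iff.1 ha); omega)
        (fun a ha => by
          have := List.mem_range'_1.1 ((descWord_perm m (Nat.find hL)).mem_iff.1 ha); omega), hs]
      simp only [pairWord, List.nil_append, zero_add, not_lt_zero, if_false] at h1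
      rw [h1]
      have h2 : R (Nat.find hL) = 0 := Nat.find_spec hL
      split_ifs with hi
      · have : R i ≠ 0 := Nat.find_min hL hi
        omega
      · have := hR (not_lt.1 hi)
        omega

/-- A descent whose removal moves a box of the insertion tableau from row `j` up to row `i`. -/
theorem exists_word_move {R : ℕ → ℕ} (hR : Antitone R) (hL : ∃ L, R L = 0) {i j : ℕ} (hij : i < j)
    (hj : R (j + 1) < R j) (hi : ∀ r < i, R i < R r) :
    ∃ (m : ℕ) (u v : List ℕ) (a b : ℕ), a < b ∧ (u ++ [b, a] ++ v).Perm (List.range' 1 m) ∧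
      (∀ r, (insertWord [] (u ++ [b, a] ++ v)).shape.getD r 0 = R r) ∧
      ∀ r, (insertWord [] (u ++ [a, b] ++ v)).shape.getD r 0 + (if r = j then 1 else 0) =
        R r + if r = i then 1 else 0 := by
  have hRj : ∀ r ≤ j, R j ≤ R r := fun r hr => hR hr
  have hRi : R j ≤ R i := hR hij.le
  -- Remove columns of heights `i` and `j + 1`. The strict drops of `R` after row `j` and before row
  -- `i` keep the remaining row lengths weakly decreasing.
  obtain ⟨m, w, hw, hs⟩ := exists_word_shape (R 0)
    (fun r => R r - (if r < i then 1 else 0) - if r ≤ j then 1 else 0)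
    (antitone_nat_of_succ_le fun r => by
      have h1 : R (r + 1) ≤ R r := hR (Nat.le_succ r)
      have h2 : r = j → R (r + 1) < R r := by rintro rfl; exact hj
      have h3 : r + 1 = i → R (r + 1) < R r := by rintro rfl; exact hi r (Nat.lt_succ_self r)
      split_ifs <;> omega)
    (hL.imp fun L h => by simp [h]) (by omega)
  obtain ⟨t, rfl⟩ : ∃ t, j = i + 1 + t := ⟨j - (i + 1), by omega⟩
  have hmem : ∀ a ∈ w, a ≤ m := fun a ha => by
    have := List.mem_range'_1.1 (hw.mem_iff.1 ha); omega
  -- The same two letters either begin a decreasing run of length `t + 2` or, once exchanged, form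
  -- pair number `i + 1`.
  have e1 : w ++ pairWord (m + (t + 2)) i ++ [m + t + 2, m + t + 1] ++ descWord m t =
      w ++ (pairWord (m + (t + 2)) i ++ descWord m (t + 2)) := by
    simp [descWord, add_assoc]
  have e2 : w ++ pairWord (m + (t + 2)) i ++ [m + t + 1, m + t + 2] ++ descWord m t =
      w ++ (pairWord (m + t) (i + 1) ++ descWord m t) := by
    simp [pairWord, add_assoc]
  have hlow : ∀ s b, ∀ a ∈ pairWord (m + s) b ++ descWord m s, m < a := fun s b a ha => by
    have := List.mem_range'_1.1 ((pairWord_append_descWord_perm m s b).mem_iff.1 ha); omega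
  refine ⟨m + (t + 2 + 2 * i), w ++ pairWord (m + (t + 2)) i, descWord m t, m + t + 1, m + t + 2,
    by omega, ?_, fun r => ?_, fun r => ?_⟩
  · rw [e1]
    have := hw.append (pairWord_append_descWord_perm m (t + 2) i)
    rwa [add_comm m 1, List.range'_append_1] at this
  · rw [e1, shape_insertWord_append hmem (hlow _ _), hs, shape_pairWord_descWord]
    have h1 := hi r
    have h2 := hRj r
    split_ifs <;> omega
  · rw [e2, shape_insertWord_append hmem (hlow _ _), hs, shape_pairWord_descWord]
    have h1 := hi r
    have h2 := hRj r
    split_ifs <;> omega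

/-! ### Partitions as lists and as functions -/

theorem sum_take_eq (l : List ℕ) (k : ℕ) :
    (l.take k).sum = ∑ i ∈ Finset.range k, l.getD i 0 := by
  induction l generalizing k with
  | nil => simp
  | cons a l ih =>
    cases k with
    | zero => simp
    | succ k => simp [Finset.sum_range_succ', ih, add_comm]

theorem list_eq_of_getD_eq : ∀ {l l' : List ℕ}, 0 ∉ l → 0 ∉ l' →
    (∀ i, l.getD i 0 = l'.getD i 0) → l = l'
  | [], [], _, _, _ => rfl
  | [], b :: l', _, h, he => by
    have := he 0
    simp_all
  | a :: l, [], h, _, he => by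
    have := he 0
    simp_all
  | a :: l, b :: l', h, h', he => by
    have h1 : a = b := by simpa using he 0
    have h2 := list_eq_of_getD_eq (l := l) (l' := l') (fun hm => h (by simp [hm]))
      (fun hm => h' (by simp [hm])) fun i => by simpa using he (i + 1)
    rw [h1, h2]

theorem antitone_getD {l : List ℕ} (h : l.Pairwise (· ≥ ·)) : Antitone fun i => l.getD i 0 := by
  refine antitone_nat_of_succ_le fun i => ?_
  by_cases hi : i + 1 < l.length
  · have := List.pairwise_iff_getElem.1 h i (i + 1) (by omega) hi (Nat.lt_succ_self i)
    rwa [List.getD_eq_getElem _ _ hi, List.getD_eq_getElem _ _ (by omega : i < l.length)]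
  · rw [List.getD_eq_default _ _ (by omega)]
    exact Nat.zero_le _

theorem pairwise_of_antitone_getD {l : List ℕ} (h : Antitone fun i => l.getD i 0) :
    l.Pairwise (· ≥ ·) := by
  refine List.pairwise_iff_getElem.2 fun i j hi hj hij => ?_
  have := h hij.le
  simp only at this
  rwa [List.getD_eq_getElem _ _ hi, List.getD_eq_getElem _ _ hj] at this

theorem sum_sortedParts {n : ℕ} (lam : n.Partition) : (sortedParts lam).sum = n := by
  rw [← Multiset.sum_coe, sortedParts, Multiset.sort_eq, lam.parts_sum]

theorem zero_notMem_sortedParts {n : ℕ} (lam : n.Partition) : 0 ∉ sortedParts lam := by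
  rw [sortedParts, Multiset.mem_sort]
  exact fun h => (lam.parts_pos h).ne rfl

theorem sortedParts_injective {n : ℕ} : Function.Injective (sortedParts (n := n)) := by
  intro lam mu h
  ext1
  rw [← Multiset.sort_eq lam.parts (· ≥ ·), ← Multiset.sort_eq mu.parts (· ≥ ·)]
  exact congrArg _ h

theorem antitone_sortedParts {n : ℕ} (lam : n.Partition) :
    Antitone fun i => (sortedParts lam).getD i 0 :=
  antitone_getD (Multiset.pairwise_sort _ _)

theorem exists_sortedParts_eq {n : ℕ} {l : List ℕ} (h0 : 0 ∉ l) (hs : l.sum = n)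
    (h : l.Pairwise (· ≥ ·)) : ∃ lam : n.Partition, sortedParts lam = l := by
  refine ⟨⟨l, fun {i} hi => Nat.pos_of_ne_zero fun h => h0 (by simpa [h] using hi), by simpa⟩, ?_⟩
  refine List.Perm.eq_of_pairwise' (r := (· ≥ ·)) (Multiset.pairwise_sort _ _) h ?_
  exact Multiset.coe_eq_coe.1 (Multiset.sort_eq _ _)

theorem domLE_iff {n : ℕ} {lam mu : n.Partition} : DomLE lam mu ↔
    ∀ k, ∑ i ∈ Finset.range k, (sortedParts lam).getD i 0 ≤
      ∑ i ∈ Finset.range k, (sortedParts mu).getD i 0 := by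
  simp only [DomLE, sum_take_eq]

theorem DomLE.refl {n : ℕ} (lam : n.Partition) : DomLE lam lam := fun _ => le_rfl

theorem DomLE.trans {n : ℕ} {a b c : n.Partition} (h : DomLE a b) (h' : DomLE b c) : DomLE a c :=
  fun k => (h k).trans (h' k)

theorem DomLE.antisymm {n : ℕ} {a b : n.Partition} (h : DomLE a b) (h' : DomLE b a) : a = b := by
  rw [domLE_iff] at h h'
  refine sortedParts_injective (list_eq_of_getD_eq (zero_notMem_sortedParts a)
    (zero_notMem_sortedParts b) fun i => ?_)
  have h1 := (h i).antisymm (h' i)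
  have h2 := (h (i + 1)).antisymm (h' (i + 1))
  rw [Finset.sum_range_succ, Finset.sum_range_succ] at h2
  omega

/-- If `M` is strictly below `L` in the dominance order, a box of `M` can be moved from a row `j`
up to a row `i` without leaving the sequences below `L`. -/
theorem exists_rows {M L : ℕ → ℕ} (hL : Antitone L)
    (hle : ∀ k, ∑ r ∈ Finset.range k, M r ≤ ∑ r ∈ Finset.range k, L r) (hne : ∃ i, M i ≠ L i)
    {K : ℕ} (hK : ∀ k, K ≤ k → ∑ r ∈ Finset.range k, M r = ∑ r ∈ Finset.range k, L r) :
    ∃ i j, i < j ∧ M (j + 1) < M j ∧ (∀ r < i, M i < M r) ∧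
      ∀ k, ∑ r ∈ Finset.range k, M r + (if i < k ∧ k ≤ j then 1 else 0) ≤
        ∑ r ∈ Finset.range k, L r := by
  classical
  -- Row `i` is the first where the sequences differ, and `j > i` is the first row after which the
  -- partial sums agree again. In between they differ strictly, which leaves room for one more box.
  obtain ⟨i, hi, himin⟩ : ∃ i, M i ≠ L i ∧ ∀ r < i, M r = L r :=
    ⟨Nat.find hne, Nat.find_spec hne, fun r hr => not_not.1 (Nat.find_min hne hr)⟩
  have hsum : ∑ r ∈ Finset.range i, M r = ∑ r ∈ Finset.range i, L r :=
    Finset.sum_congr rfl fun r hr => himin r (Finset.mem_range.1 hr)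
  have hi1 := hle (i + 1)
  rw [Finset.sum_range_succ, Finset.sum_range_succ] at hi1
  have hj : ∃ j, i < j ∧ ∑ r ∈ Finset.range (j + 1), M r = ∑ r ∈ Finset.range (j + 1), L r :=
    ⟨i + 1 + K, by omega, hK _ (by omega)⟩
  obtain ⟨j, ⟨hij, hj⟩, hjmin⟩ : ∃ j, (i < j ∧
      ∑ r ∈ Finset.range (j + 1), M r = ∑ r ∈ Finset.range (j + 1), L r) ∧
      ∀ k < j, ¬ (i < k ∧
        ∑ r ∈ Finset.range (k + 1), M r = ∑ r ∈ Finset.range (k + 1), L r) :=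
    ⟨Nat.find hj, Nat.find_spec hj, fun k => Nat.find_min hj⟩
  have hlt : ∀ k, i < k → k ≤ j → ∑ r ∈ Finset.range k, M r < ∑ r ∈ Finset.range k, L r := by
    intro k hik hkj
    obtain ⟨k, rfl⟩ : ∃ k', k = k' + 1 := ⟨k - 1, by omega⟩
    rcases (Nat.lt_succ_iff.1 hik).eq_or_lt with rfl | hik
    · rw [Finset.sum_range_succ, Finset.sum_range_succ]
      omega
    · exact lt_of_le_of_ne (hle _) fun h => hjmin k (by omega) ⟨hik, h⟩
  refine ⟨i, j, hij, ?_, fun r hr => ?_, fun k => ?_⟩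
  -- The partial sums catch up at row `j`, so `L j < M j`; they do not overtake at the next row, so
  -- `M (j + 1) ≤ L (j + 1) ≤ L j`.
  · have h1 := hlt j hij le_rfl
    have h2 := hle (j + 2)
    have h3 : L (j + 1) ≤ L j := hL (Nat.le_succ j)
    rw [Finset.sum_range_succ M (j + 1), Finset.sum_range_succ L (j + 1), hj] at h2
    rw [Finset.sum_range_succ, Finset.sum_range_succ] at hj
    omega
  · have h1 : L i ≤ L r := hL hr.le
    have h2 := himin r hr
    omega
  · split_ifs with h
    · exact hlt k h.1 h.2
    · exact hle k

/-! ### Descents realizing dominance, and chains of them -/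

theorem sum_shape (T : Tableau) : T.shape.sum = (reading T).length := by
  induction T with
  | nil => rfl
  | cons r T ih => simp_all [Tableau.shape, reading, add_comm]

theorem sum_shape_insertWord {w : List ℕ} (hw : w.Nodup) :
    (insertWord [] w).shape.sum = w.length := by
  rw [sum_shape, ← (insertWord_spec w hw).2.1.length_eq]

theorem zero_notMem_shape_insertWord {w : List ℕ} (hw : w.Nodup) :
    0 ∉ (insertWord [] w).shape := by
  intro h
  obtain ⟨r, hr, h⟩ := List.mem_map.1 h
  exact ((insertWord_spec w hw).1.1 r hr).1 (List.length_eq_zero_iff.1 h)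

/-- Whenever `mu < lam` in the dominance order, some `x` in `J mu` has a descent `s` such that the
shape of `x * s` lies above `mu` and below `lam`. -/
theorem exists_descent {n : ℕ} {lam mu : n.Partition} (h : DomLT mu lam) :
    ∃ (x s : Equiv.Perm (Fin n)) (nu : n.Partition), x ∈ J mu ∧ IsSimple s ∧
      length (x * s) < length x ∧ x * s ∈ J nu ∧ DomLE nu lam ∧ DomLT mu nu := by
  obtain ⟨hle, hne⟩ := h
  rw [domLE_iff] at hle
  have hne' : ∃ i, (sortedParts mu).getD i 0 ≠ (sortedParts lam).getD i 0 := by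
    by_contra! hc
    exact hne (sortedParts_injective (list_eq_of_getD_eq (zero_notMem_sortedParts mu)
      (zero_notMem_sortedParts lam) hc))
  obtain ⟨i, j, hij, hj, hi, hk⟩ := exists_rows (antitone_sortedParts lam) hle hne'
    (K := (sortedParts mu).length + (sortedParts lam).length) (fun k hk => by
      rw [← sum_take_eq, ← sum_take_eq, List.take_of_length_le (by omega),
        List.take_of_length_le (by omega), sum_sortedParts, sum_sortedParts])
  obtain ⟨m, u, v, a, b, hab, hp, hx, hy⟩ := exists_word_move (antitone_sortedParts mu)
    ⟨_, List.getD_eq_default _ _ le_rfl⟩ hij hj hi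
  have hd : (u ++ [b, a] ++ v).Nodup := hp.nodup_iff.2 List.nodup_range'
  have hshape := list_eq_of_getD_eq (zero_notMem_shape_insertWord hd) (zero_notMem_sortedParts mu)
    hx
  obtain rfl : m = n := by
    rw [← sum_sortedParts mu, ← hshape, sum_shape_insertWord hd, hp.length_eq, List.length_range']
  obtain ⟨x, hxw⟩ := exists_word_eq hp
  obtain ⟨p, q, hpq, hdesc, hyw⟩ := word_mul_swap hxw hab
  have hd' := word_nodup (x * Equiv.swap p q)
  rw [hyw] at hd'
  have hanti : Antitone fun r => (insertWord [] (u ++ [a, b] ++ v)).shape.getD r 0 := by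
    refine antitone_nat_of_succ_le fun r => ?_
    have h1 := hy r
    have h2 := hy (r + 1)
    have h3 : (sortedParts mu).getD (r + 1) 0 ≤ (sortedParts mu).getD r 0 :=
      antitone_sortedParts mu (Nat.le_succ r)
    have h4 : r = j → (sortedParts mu).getD (r + 1) 0 < (sortedParts mu).getD r 0 := by
      rintro rfl; exact hj
    have h5 : r + 1 = i → (sortedParts mu).getD (r + 1) 0 < (sortedParts mu).getD r 0 := by
      rintro rfl; exact hi r (Nat.lt_succ_self r)
    split_ifs at h1 h2 <;> omega
  obtain ⟨nu, hnu⟩ := exists_sortedParts_eq (n := m) (zero_notMem_shape_insertWord hd')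
    (by rw [sum_shape_insertWord hd', ← hyw, word, List.length_ofFn])
    (pairwise_of_antitone_getD hanti)
  simp only [← hnu] at hy
  -- Moving the box raises the partial sums by one exactly for `i < k ≤ j`, the range in which `hk`
  -- provides the room.
  have hsum : ∀ k, ∑ r ∈ Finset.range k, (sortedParts nu).getD r 0 + (if j < k then 1 else 0) =
      ∑ r ∈ Finset.range k, (sortedParts mu).getD r 0 + if i < k then 1 else 0 := by
    intro k
    have := Finset.sum_congr (rfl : Finset.range k = Finset.range k) fun r _ => hy r
    simpa [Finset.sum_add_distrib] using this
  refine ⟨x, Equiv.swap p q, nu, ?_, ⟨p, q, hpq, rfl⟩,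
    length_mul_swap_lt (Fin.lt_def.2 (by omega)) hdesc, ?_, ?_, ?_, ?_⟩
  · exact (shape_Q x).trans (by rw [hxw, hshape])
  · exact (shape_Q _).trans (by rw [hyw, hnu])
  · rw [domLE_iff]
    intro k
    have h1 := hsum k
    have h2 := hk k
    split_ifs at h1 h2 <;> omega
  · rw [domLE_iff]
    intro k
    have h1 := hsum k
    split_ifs at h1 <;> omega
  · rintro rfl
    have h1 := hy i
    rw [if_neg hij.ne, if_pos rfl] at h1
    omega

theorem exists_chain {n : ℕ} (lam mu : n.Partition) (h : DomLE mu lam) :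
    Relation.ReflTransGen
      (fun a b : n.Partition => ∃ x ∈ J a, ∃ y ∈ J b, WeakLE y x) mu lam := by
  -- Induction runs upwards from `mu` to `lam`, which is legitimate because there are finitely many
  -- partitions.
  have wf : WellFounded fun a b : n.Partition => DomLT b a :=
    haveI : IsTrans n.Partition fun a b => DomLT b a :=
      ⟨fun a b c hab hbc =>
        ⟨hbc.1.trans hab.1, fun e => hab.2 (hab.1.antisymm (e ▸ hbc.1))⟩⟩
    haveI : Std.Irrefl fun a b : n.Partition => DomLT b a := ⟨fun a ha => ha.2 rfl⟩
    Finite.wellFounded_of_trans_of_irrefl _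
  induction mu using wf.induction with
  | _ mu ih =>
    by_cases hne : mu = lam
    · rw [hne]
    · obtain ⟨x, s, nu, hx, hs, hl, hy, hnu, hlt⟩ := exists_descent ⟨h, hne⟩
      refine Relation.ReflTransGen.head ⟨x, hx, x * s, hy, ?_⟩ (ih nu hlt hnu)
      refine Relation.ReflTransGen.single ⟨s, hs, ?_, hl⟩
      obtain ⟨i, j, -, rfl⟩ := hs
      rw [mul_assoc, Equiv.swap_mul_self, mul_one]

theorem domLE_of_chain {n : ℕ} {lam mu : n.Partition} (h : Relation.ReflTransGen
    (fun a b : n.Partition => ∃ x ∈ J a, ∃ y ∈ J b, WeakLE y x) mu lam) : DomLE mu lam := by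
  induction h with
  | refl => exact DomLE.refl _
  | tail _ hbc ih =>
    obtain ⟨x, hx, y, hy, hyx⟩ := hbc
    exact ih.trans (domLE_of_weakLE hx hy hyx)

theorem bruhatLT_of_length_lt {n : ℕ} {x s : Equiv.Perm (Fin n)} (hs : IsSimple s)
    (h : length (x * s) < length x) : BruhatLT (x * s) x := by
  obtain ⟨i, j, hij, rfl⟩ := hs
  refine Relation.TransGen.single ⟨Equiv.swap i j, ⟨i, j, ?_, rfl⟩, ?_, h⟩
  · rintro rfl
    omega
  · rw [mul_assoc, Equiv.swap_mul_self, mul_one]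

end DominanceWeakOrder

theorem mainTheorem11 (n : ℕ) :
    (∀ lam mu : n.Partition,
      DominanceWeakOrder.DomLE mu lam ↔
        Relation.ReflTransGen
          (fun a b : n.Partition => ∃ x ∈ DominanceWeakOrder.J a, ∃ y ∈ DominanceWeakOrder.J b,
            DominanceWeakOrder.WeakLE y x) mu lam) ∧
    (∀ lam mu : n.Partition, DominanceWeakOrder.DomLT mu lam →
      ∃ (x s : Equiv.Perm (Fin n)) (nu : n.Partition),
        x ∈ DominanceWeakOrder.J mu ∧
        DominanceWeakOrder.IsSimple s ∧
        DominanceWeakOrder.BruhatLT (x * s) x ∧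
        x * s ∈ DominanceWeakOrder.J nu ∧
        DominanceWeakOrder.DomLE nu lam ∧
        DominanceWeakOrder.DomLT mu nu) := by
  refine ⟨fun lam mu => ⟨DominanceWeakOrder.exists_chain lam mu,
    DominanceWeakOrder.domLE_of_chain⟩, fun lam mu h => ?_⟩
  obtain ⟨x, s, nu, hx, hs, hl, hy⟩ := DominanceWeakOrder.exists_descent h
  exact ⟨x, s, nu, hx, hs, DominanceWeakOrder.bruhatLT_of_length_lt hs hl, hy⟩
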